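/- Let $m\ge 0$ be an integer, let $a,b,c_1,\dots,c_m\in\mathbb{C}$ be arbitrary, and let $D=\mathbb{C}\langle x_1,\dots,x_m,\partial_1,\dots,\partial_m\rangle$ be the Weyl algebra, that is, the $\mathbb{C}$-algebra with relations $x_ix_j=x_jx_i$, $\partial_i\partial_j=\partial_j\partial_i$, $\partial_ix_j=x_j\partial_i+\delta_{ij}$. Put $\theta_i=x_i\partial_i$, $\theta=\theta_1+\cdots+\theta_m$, and let $I(m)$ be the left ideal of $D$ generated by the Lauricella operators $$\ell_i=\theta_i(\theta_i+c_i-1)-x_i(\theta+a)(\theta+b),\qquad i=1,\dots,m.$$ For a nonzero $p=\sum c_{\alpha\beta}x^\alpha\partial^\beta\in D$ (written uniquely in this form), its principal symbol is $\sum_{|\beta|=d}c_{\alpha\beta}x^\alpha\xi^\beta\in\mathbb{C}[x,\xi]=\mathbb{C}[x_1,\dots,x_m,\xi_1,\dots,\xi_m]$, where $d$ is the maximum of $|\beta|=\beta_1+\cdots+\beta_m$ over all $(\alpha,\beta)$ with $c_{\alpha\beta}\neq0$. For a left ideal $I$ of $D$, the characteristic variety $\mathrm{Ch}(I)\subseteq\mathbb{C}^{2m}$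 is the zero set of the ideal of $\mathbb{C}[x,\xi]$ generated by the principal symbols of all nonzero elements of $I$, and $I$ is called holonomic if $\mathrm{Ch}(I)$ has (Krull) dimension $m$. **Proposition.** The characteristic variety $\mathrm{Ch}(I(m))$ has dimension $m$; that is, the left ideal $I(m)$ is holonomic. -/

import Mathlib

noncomputable section

/-- Index set of the `2m` generators: `Sum.inl i` stands for `x_i`, `Sum.inr i` for `∂_i`
(or, on the commutative side, for `ξ_i`). -/
abbrev WIdx (m : ℕ) : Type := Fin m ⊕ Fin m

/-- The defining relations of the Weyl algebra:
`x_i x_j = x_j x_i`, `∂_i ∂_j = ∂_j ∂_i`, `∂_i x_j = x_j ∂_i + δ_{ij}`. -/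
inductive WeylRel (m : ℕ) : FreeAlgebra ℂ (WIdx m) → FreeAlgebra ℂ (WIdx m) → Prop
  | x_x (i j : Fin m) : WeylRel m
      (FreeAlgebra.ι ℂ (Sum.inl i) * FreeAlgebra.ι ℂ (Sum.inl j))
      (FreeAlgebra.ι ℂ (Sum.inl j) * FreeAlgebra.ι ℂ (Sum.inl i))
  | d_d (i j : Fin m) : WeylRel m
      (FreeAlgebra.ι ℂ (Sum.inr i) * FreeAlgebra.ι ℂ (Sum.inr j))
      (FreeAlgebra.ι ℂ (Sum.inr j) * FreeAlgebra.ι ℂ (Sum.inr i))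
  | d_x (i j : Fin m) : WeylRel m
      (FreeAlgebra.ι ℂ (Sum.inr i) * FreeAlgebra.ι ℂ (Sum.inl j))
      (FreeAlgebra.ι ℂ (Sum.inl j) * FreeAlgebra.ι ℂ (Sum.inr i) + if i = j then 1 else 0)

/-- The Weyl algebra `D = ℂ⟨x_1, …, x_m, ∂_1, …, ∂_m⟩`. -/
def Weyl (m : ℕ) : Type := RingQuot (WeylRel m)

namespace Weyl

instance (m : ℕ) : Ring (Weyl m) := inferInstanceAs (Ring (RingQuot (WeylRel m)))

instance (m : ℕ) : Algebra ℂ (Weyl m) := inferInstanceAs (Algebra ℂ (RingQuot (WeylRel m)))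

variable {m : ℕ}

/-- The quotient map from the free algebra. -/
def mk (m : ℕ) : FreeAlgebra ℂ (WIdx m) →ₐ[ℂ] Weyl m := RingQuot.mkAlgHom ℂ (WeylRel m)

/-- The variable `x_i` as an element of the Weyl algebra. -/
def x (i : Fin m) : Weyl m := mk m (FreeAlgebra.ι ℂ (Sum.inl i))

/-- The derivation `∂_i` as an element of the Weyl algebra. -/
def d (i : Fin m) : Weyl m := mk m (FreeAlgebra.ι ℂ (Sum.inr i))

theorem mk_surjective : Function.Surjective (mk m) := RingQuot.mkAlgHom_surjective ℂ (WeylRel m)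

theorem x_commute (i j : Fin m) : Commute (x i : Weyl m) (x j) := by
  have h := RingQuot.mkAlgHom_rel ℂ (WeylRel.x_x i j)
  rw [map_mul, map_mul] at h
  exact h

theorem d_commute (i j : Fin m) : Commute (d i : Weyl m) (d j) := by
  have h := RingQuot.mkAlgHom_rel ℂ (WeylRel.d_d i j)
  rw [map_mul, map_mul] at h
  exact h

theorem d_mul_x (i j : Fin m) :
    (d i * x j : Weyl m) = x j * d i + if i = j then 1 else 0 := by
  have h := RingQuot.mkAlgHom_rel ℂ (WeylRel.d_x i j)
  rw [map_mul, map_add, map_mul, apply_ite (RingQuot.mkAlgHom ℂ (WeylRel m)), map_one,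
    map_zero] at h
  exact h

theorem pow_pairwise_commute {A : Type*} [Monoid A] (f : Fin m → A)
    (hf : ∀ i j, Commute (f i) (f j)) (α : Fin m → ℕ) :
    ((Finset.univ : Finset (Fin m)) : Set (Fin m)).Pairwise
      (Function.onFun Commute fun i => f i ^ α i) :=
  fun i _ j _ _ => (hf i j).pow_pow _ _

/-- The product `∏ i, f i ^ α i` of pairwise commuting elements. -/
def commPow {A : Type*} [Monoid A] (f : Fin m → A) (hf : ∀ i j, Commute (f i) (f j))
    (α : Fin m → ℕ) : A :=
  Finset.univ.noncommProd (fun i => f i ^ α i) (pow_pairwise_commute f hf α)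

theorem commPow_zero {A : Type*} [Monoid A] (f : Fin m → A) (hf : ∀ i j, Commute (f i) (f j)) :
    commPow f hf 0 = 1 := by
  unfold commPow
  rw [Finset.noncommProd_eq_pow_card _ _ _ 1 (by simp)]
  simp

theorem commPow_add {A : Type*} [Monoid A] (f : Fin m → A) (hf : ∀ i j, Commute (f i) (f j))
    (α β : Fin m → ℕ) : commPow f hf (α + β) = commPow f hf α * commPow f hf β := by
  unfold commPow
  rw [← Finset.noncommProd_mul_distrib]
  · refine Finset.noncommProd_congr rfl (fun i _ => ?_) _
    simp [pow_add]
  · exact fun i _ j _ _ => (hf i j).pow_pow _ _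

theorem commPow_single {A : Type*} [Monoid A] (f : Fin m → A)
    (hf : ∀ i j, Commute (f i) (f j)) (j : Fin m) :
    commPow f hf (Pi.single j 1) = f j := by
  have hc : ((Finset.univ.erase j : Finset (Fin m)) : Set (Fin m)).Pairwise
      (Function.onFun Commute fun i => f i ^ (Pi.single j 1 : Fin m → ℕ) i) :=
    fun i _ k _ _ => (hf i k).pow_pow _ _
  have h := Finset.noncommProd_erase_mul Finset.univ (Finset.mem_univ j)
    (fun i => f i ^ (Pi.single j 1 : Fin m → ℕ) i) (pow_pairwise_commute f hf _) hc
  rw [Finset.noncommProd_eq_pow_card _ _ hc 1 (fun i hi => by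
    simp [Pi.single_eq_of_ne (Finset.ne_of_mem_erase hi)])] at h
  unfold commPow
  rw [← h]
  simp

/-- The normally ordered monomial `x^α ∂^β` with exponents `α = s ∘ inl`, `β = s ∘ inr`. -/
def normalMonomial (s : WIdx m →₀ ℕ) : Weyl m :=
  commPow x x_commute (fun i => s (Sum.inl i)) * commPow d d_commute (fun i => s (Sum.inr i))

/-- The linear map `∑ c_{αβ} x^α ξ^β ↦ ∑ c_{αβ} x^α ∂^β`. -/
def normalOrder (m : ℕ) : MvPolynomial (WIdx m) ℂ →ₗ[ℂ] Weyl m :=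
  (MvPolynomial.basisMonomials (WIdx m) ℂ).constr ℂ normalMonomial

theorem normalOrder_monomial (s : WIdx m →₀ ℕ) (c : ℂ) :
    normalOrder m (MvPolynomial.monomial s c) = c • normalMonomial s := by
  have h : MvPolynomial.monomial s c = c • MvPolynomial.basisMonomials (WIdx m) ℂ s := by
    simp [MvPolynomial.smul_monomial]
  rw [h, map_smul, normalOrder, Module.Basis.constr_basis]

theorem normalMonomial_zero : normalMonomial (0 : WIdx m →₀ ℕ) = 1 := by
  have h1 := commPow_zero (x : Fin m → Weyl m) x_commute
  have h2 := commPow_zero (d : Fin m → Weyl m) d_commute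
  change commPow x x_commute 0 * commPow d d_commute 0 = 1
  rw [h1, h2, one_mul]

theorem x_mul_normalMonomial (j : Fin m) (s : WIdx m →₀ ℕ) :
    x j * normalMonomial s = normalMonomial (Finsupp.single (Sum.inl j) 1 + s) := by
  unfold normalMonomial
  rw [← mul_assoc, ← commPow_single x x_commute j, ← commPow_add]
  congr 2
  · funext i
    simp [Finsupp.single_apply, Pi.single_apply, eq_comm]
  · funext i
    simp

theorem d_mul_normalMonomial_inr (j : Fin m) (s : WIdx m →₀ ℕ) (hs : ∀ i, s (Sum.inl i) = 0) :
    d j * normalMonomial s = normalMonomial (Finsupp.single (Sum.inr j) 1 + s) := by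
  have h0 : (fun i => s (Sum.inl i)) = 0 := funext hs
  have h1 : (fun i => (Finsupp.single (Sum.inr j) 1 + s : WIdx m →₀ ℕ) (Sum.inl i)) = 0 := by
    funext i
    simp [hs]
  unfold normalMonomial
  rw [h0, h1, commPow_zero, one_mul, one_mul, ← commPow_single d d_commute j, ← commPow_add]
  congr 1
  funext i
  simp [Finsupp.single_apply, Pi.single_apply, eq_comm]

theorem x_mul_normalOrder (j : Fin m) (p : MvPolynomial (WIdx m) ℂ) :
    x j * normalOrder m p = normalOrder m (MvPolynomial.X (Sum.inl j) * p) := by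
  induction p using MvPolynomial.induction_on' with
  | monomial s c =>
    rw [MvPolynomial.X, MvPolynomial.monomial_mul, one_mul, normalOrder_monomial,
      normalOrder_monomial, mul_smul_comm, x_mul_normalMonomial]
  | add p q hp hq => rw [map_add, mul_add, hp, hq, mul_add, map_add]

theorem d_mul_normalOrder (j : Fin m) (p : MvPolynomial (WIdx m) ℂ) :
    d j * normalOrder m p = normalOrder m
      (MvPolynomial.X (Sum.inr j) * p + MvPolynomial.pderiv (Sum.inl j) p) := by
  suffices h : ∀ (n : ℕ) (s : WIdx m →₀ ℕ), (∑ i, s (Sum.inl i)) = n →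
      d j * normalOrder m (MvPolynomial.monomial s 1) = normalOrder m
        (MvPolynomial.X (Sum.inr j) * MvPolynomial.monomial s 1 +
          MvPolynomial.pderiv (Sum.inl j) (MvPolynomial.monomial s 1)) by
    induction p using MvPolynomial.induction_on' with
    | monomial s c =>
      have hc : MvPolynomial.monomial s c = c • MvPolynomial.monomial s (1 : ℂ) := by
        simp [MvPolynomial.smul_monomial]
      rw [hc, map_smul, mul_smul_comm, h _ s rfl, Derivation.map_smul, mul_smul_comm, ← smul_add,
        map_smul]
    | add p q hp hq =>
      rw [map_add, mul_add, hp, hq, ← map_add]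
      congr 1
      rw [mul_add, Derivation.map_add]
      abel
  intro n
  induction n with
  | zero =>
    intro s hs
    have hs' : ∀ i, s (Sum.inl i) = 0 := by simpa using hs
    rw [normalOrder_monomial, one_smul, d_mul_normalMonomial_inr j s hs',
      MvPolynomial.pderiv_monomial, hs', MvPolynomial.X, MvPolynomial.monomial_mul]
    simp [normalOrder_monomial]
  | succ n ih =>
    intro s hs
    obtain ⟨i, hi⟩ : ∃ i, s (Sum.inl i) ≠ 0 := by
      by_contra! hcon
      simp [hcon] at hs
    obtain ⟨t, rfl⟩ : ∃ t, s = Finsupp.single (Sum.inl i) 1 + t :=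
      exists_add_of_le (by
        rw [Finsupp.single_le_iff]
        omega)
    have ht : ∑ k, t (Sum.inl k) = n := by
      have : ∑ k, (Finsupp.single (Sum.inl i) 1 : WIdx m →₀ ℕ) (Sum.inl k) = 1 := by
        simp [Finsupp.single_apply]
      simp only [Finsupp.add_apply, Finset.sum_add_distrib, this] at hs
      omega
    have hX : (MvPolynomial.monomial (Finsupp.single (Sum.inl i) 1 + t) (1 : ℂ)) =
        MvPolynomial.X (Sum.inl i) * MvPolynomial.monomial t 1 := by
      rw [MvPolynomial.X, MvPolynomial.monomial_mul, one_mul]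
    rw [hX, ← x_mul_normalOrder, ← mul_assoc, d_mul_x, add_mul, mul_assoc, ih t ht,
      x_mul_normalOrder, Derivation.leibniz, MvPolynomial.pderiv_X]
    have hite : (if j = i then (1 : Weyl m) else 0) * normalOrder m (MvPolynomial.monomial t 1) =
        normalOrder m ((if j = i then 1 else 0) * MvPolynomial.monomial t 1) := by
      split_ifs <;> simp
    rw [hite, ← map_add]
    congr 1
    by_cases hji : j = i
    · subst hji
      simp
      ring
    · have : (Sum.inl i : WIdx m) ≠ Sum.inl j := fun h => hji (Sum.inl_injective h).symm
      simp [hji, this]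
      ring

/-- The operators on `ℂ[x, ξ]` by which `x_j` and `∂_j` act on normally ordered expressions. -/
def symbolGen (m : ℕ) : WIdx m → Module.End ℂ (MvPolynomial (WIdx m) ℂ)
  | Sum.inl j => LinearMap.mulLeft ℂ (MvPolynomial.X (Sum.inl j))
  | Sum.inr j => LinearMap.mulLeft ℂ (MvPolynomial.X (Sum.inr j)) +
      (MvPolynomial.pderiv (R := ℂ) (Sum.inl j : WIdx m)).toLinearMap

/-- Left multiplication of the Weyl algebra on itself, in normally ordered coordinates. -/
def symbolAction (m : ℕ) : Weyl m →ₐ[ℂ] Module.End ℂ (MvPolynomial (WIdx m) ℂ) :=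
  RingQuot.liftAlgHom ℂ ⟨FreeAlgebra.lift ℂ (symbolGen m), by
    rintro _ _ (⟨i, j⟩ | ⟨i, j⟩ | ⟨i, j⟩)
    · simp only [map_mul, FreeAlgebra.lift_ι_apply]
      refine LinearMap.ext fun p => ?_
      simp [symbolGen]
      ring
    · simp only [map_mul, FreeAlgebra.lift_ι_apply]
      refine LinearMap.ext fun p => ?_
      have hc : MvPolynomial.pderiv (Sum.inl i) (MvPolynomial.pderiv (Sum.inl j) p) =
          MvPolynomial.pderiv (Sum.inl j) (MvPolynomial.pderiv (Sum.inl i) p) := by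
        have h0 : ⁅(MvPolynomial.pderiv (R := ℂ) (Sum.inl i : WIdx m)),
            MvPolynomial.pderiv (R := ℂ) (Sum.inl j : WIdx m)⁆ = 0 := by
          refine MvPolynomial.derivation_ext fun k => ?_
          simp [Derivation.commutator_apply, MvPolynomial.pderiv_X, Pi.single_apply,
            apply_ite]
        have h1 := DFunLike.congr_fun h0 p
        rw [Derivation.commutator_apply] at h1
        exact sub_eq_zero.mp h1
      simp [symbolGen, hc, MvPolynomial.pderiv_X]
      ring
    · simp only [map_mul, map_add, FreeAlgebra.lift_ι_apply]
      refine LinearMap.ext fun p => ?_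
      by_cases hij : i = j
      · subst hij
        simp [symbolGen]
        ring
      · have : (Sum.inl j : WIdx m) ≠ Sum.inl i := fun h => hij (Sum.inl_injective h).symm
        simp [symbolGen, hij, MvPolynomial.pderiv_X, this]
        ring⟩

theorem symbolAction_mk (f : FreeAlgebra ℂ (WIdx m)) :
    symbolAction m (mk m f) = FreeAlgebra.lift ℂ (symbolGen m) f :=
  RingQuot.liftAlgHom_mkAlgHom_apply ℂ _ _ _

theorem symbolAction_x (j : Fin m) (p : MvPolynomial (WIdx m) ℂ) :
    symbolAction m (x j) p = MvPolynomial.X (Sum.inl j) * p := by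
  rw [x, symbolAction_mk, FreeAlgebra.lift_ι_apply]
  rfl

theorem symbolAction_d (j : Fin m) (p : MvPolynomial (WIdx m) ℂ) :
    symbolAction m (d j) p =
      MvPolynomial.X (Sum.inr j) * p + MvPolynomial.pderiv (Sum.inl j) p := by
  rw [d, symbolAction_mk, FreeAlgebra.lift_ι_apply]
  rfl

theorem normalOrder_symbolAction (P : Weyl m) (p : MvPolynomial (WIdx m) ℂ) :
    normalOrder m (symbolAction m P p) = P * normalOrder m p := by
  obtain ⟨f, rfl⟩ := mk_surjective P
  induction f using FreeAlgebra.induction generalizing p with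
  | grade0 c =>
    rw [AlgHom.commutes, AlgHom.commutes, Module.algebraMap_end_apply, map_smul,
      Algebra.smul_def]
  | grade1 k =>
    rcases k with j | j
    · exact (congrArg _ (symbolAction_x j p)).trans (x_mul_normalOrder j p).symm
    · exact (congrArg _ (symbolAction_d j p)).trans (d_mul_normalOrder j p).symm
  | mul f g hf hg =>
    rw [map_mul, map_mul, Module.End.mul_apply, hf, hg, mul_assoc]
  | add f g hf hg =>
    rw [map_add, map_add, LinearMap.add_apply, map_add, hf, hg, add_mul]

theorem normalOrder_one : normalOrder m 1 = 1 := by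
  change normalOrder m (MvPolynomial.monomial 0 1) = 1
  rw [normalOrder_monomial, one_smul, normalMonomial_zero]

theorem symbolAction_normalOrder (p : MvPolynomial (WIdx m) ℂ) :
    symbolAction m (normalOrder m p) 1 = p := by
  have hd : ∀ (α : Fin m → ℕ) (q : MvPolynomial (WIdx m) ℂ),
      (∀ j, MvPolynomial.pderiv (Sum.inl j) q = 0) →
      symbolAction m (commPow d d_commute α) q =
        (∏ i, MvPolynomial.X (Sum.inr i) ^ α i) * q := by
    intro α
    suffices h : ∀ (n : ℕ) (α : Fin m → ℕ), ∑ i, α i = n →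
        ∀ q : MvPolynomial (WIdx m) ℂ, (∀ j, MvPolynomial.pderiv (Sum.inl j) q = 0) →
        symbolAction m (commPow d d_commute α) q =
          (∏ i, MvPolynomial.X (Sum.inr i) ^ α i) * q from h _ α rfl
    intro n
    induction n with
    | zero =>
      intro α hα q _
      have : α = 0 := by
        funext i
        simpa using (Finset.sum_eq_zero_iff.mp hα) i (Finset.mem_univ i)
      subst this
      simp [commPow_zero]
    | succ n ih =>
      intro α hα q hq
      obtain ⟨i, hi⟩ : ∃ i, α i ≠ 0 := by
        by_contra! hcon
        simp [hcon] at hα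
      obtain ⟨β, rfl⟩ : ∃ β, α = β + Pi.single i 1 := by
        refine ⟨α - Pi.single i 1, (tsub_add_cancel_of_le fun k => ?_).symm⟩
        by_cases hk : k = i
        · subst hk
          simp
          omega
        · simp [hk]
      have hβ : ∑ k, β k = n := by
        simp [Finset.sum_add_distrib] at hα
        omega
      rw [commPow_add, commPow_single, map_mul, Module.End.mul_apply, symbolAction_d, hq,
        add_zero, ih β hβ]
      · simp only [Pi.add_apply, pow_add, Finset.prod_mul_distrib, Pi.single_apply, pow_ite,
          pow_one, pow_zero, Finset.prod_ite_eq', Finset.mem_univ, if_true, mul_assoc]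
      · intro j
        simp [hq, MvPolynomial.pderiv_X]
  have hx : ∀ (α : Fin m → ℕ) (q : MvPolynomial (WIdx m) ℂ),
      symbolAction m (commPow x x_commute α) q =
        (∏ i, MvPolynomial.X (Sum.inl i) ^ α i) * q := by
    intro α
    suffices h : ∀ (n : ℕ) (α : Fin m → ℕ), ∑ i, α i = n →
        ∀ q : MvPolynomial (WIdx m) ℂ,
        symbolAction m (commPow x x_commute α) q =
          (∏ i, MvPolynomial.X (Sum.inl i) ^ α i) * q from h _ α rfl
    intro n
    induction n with
    | zero =>
      intro α hα q
      have : α = 0 := by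
        funext i
        simpa using (Finset.sum_eq_zero_iff.mp hα) i (Finset.mem_univ i)
      subst this
      simp [commPow_zero]
    | succ n ih =>
      intro α hα q
      obtain ⟨i, hi⟩ : ∃ i, α i ≠ 0 := by
        by_contra! hcon
        simp [hcon] at hα
      obtain ⟨β, rfl⟩ : ∃ β, α = β + Pi.single i 1 := by
        refine ⟨α - Pi.single i 1, (tsub_add_cancel_of_le fun k => ?_).symm⟩
        by_cases hk : k = i
        · subst hk
          simp
          omega
        · simp [hk]
      have hβ : ∑ k, β k = n := by
        simp [Finset.sum_add_distrib] at hα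
        omega
      rw [commPow_add, commPow_single, map_mul, Module.End.mul_apply, symbolAction_x, ih β hβ]
      simp only [Pi.add_apply, pow_add, Finset.prod_mul_distrib, Pi.single_apply, pow_ite,
        pow_one, pow_zero, Finset.prod_ite_eq', Finset.mem_univ, if_true, mul_assoc]
  induction p using MvPolynomial.induction_on' with
  | monomial s c =>
    rw [normalOrder_monomial, map_smul, LinearMap.smul_apply, normalMonomial, map_mul,
      Module.End.mul_apply, hd _ 1 (by simp), hx, mul_one, MvPolynomial.monomial_eq,
      Finsupp.prod_fintype _ _ (by simp), Fintype.prod_sum_type, MvPolynomial.smul_eq_C_mul]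
  | add p q hp hq => rw [map_add, map_add, LinearMap.add_apply, hp, hq]

/-- Every element of the Weyl algebra is uniquely of the form `∑ c_{αβ} x^α ∂^β`; this is the
linear isomorphism `∑ c_{αβ} x^α ξ^β ↦ ∑ c_{αβ} x^α ∂^β`. -/
def normalOrderEquiv (m : ℕ) : MvPolynomial (WIdx m) ℂ ≃ₗ[ℂ] Weyl m :=
  LinearEquiv.ofBijective (normalOrder m)
    ⟨Function.LeftInverse.injective (g := fun P => symbolAction m P 1) symbolAction_normalOrder,
      fun P => ⟨symbolAction m P 1, by
        rw [normalOrder_symbolAction, normalOrder_one, mul_one]⟩⟩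

/-- The full symbol `∑ c_{αβ} x^α ξ^β` of `P = ∑ c_{αβ} x^α ∂^β`. -/
def fullSymbol (P : Weyl m) : MvPolynomial (WIdx m) ℂ := (normalOrderEquiv m).symm P

/-- The weight vector `(0, 1)`: weight `0` for each `x_i`, weight `1` for each `∂_i`. -/
def weight01 (m : ℕ) : WIdx m → ℕ := Sum.elim (fun _ => 0) (fun _ => 1)

/-- The order of `P`: the highest `(0, 1)`-weight of a term of `P` (junk value `0` at `P = 0`). -/
def order (P : Weyl m) : ℕ := MvPolynomial.weightedTotalDegree (weight01 m) (fullSymbol P)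

/-- The principal symbol of `P`, i.e. its `(0, 1)`-initial form: the sum of the terms
`c_{αβ} x^α ξ^β` of highest `(0, 1)`-weight. It is `0` for `P = 0`. -/
def principalSymbol (P : Weyl m) : MvPolynomial (WIdx m) ℂ :=
  MvPolynomial.weightedHomogeneousComponent (weight01 m) (order P) (fullSymbol P)

/-- The characteristic ideal of a left ideal `I` of `D`: the ideal of `ℂ[x, ξ]` generated by the
principal symbols of all elements of `I`. (`Ideal` of a noncommutative ring is a left ideal.) -/
def charIdeal (I : Ideal (Weyl m)) : Ideal (MvPolynomial (WIdx m) ℂ) :=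
  Ideal.span (principalSymbol '' (I : Set (Weyl m)))

/-- The characteristic variety: the zero set in `ℂ^{2m}` of the characteristic ideal. -/
def charVariety (I : Ideal (Weyl m)) : Set (WIdx m → ℂ) :=
  MvPolynomial.zeroLocus ℂ (charIdeal I)

end Weyl

/-- The dimension of an algebraic set `V ⊆ ℂ^σ`: the Krull dimension of its coordinate ring
`ℂ[σ] / I(V)` (so the empty set has dimension `⊥`). -/
def algebraicSetDim {σ : Type*} (V : Set (σ → ℂ)) : WithBot ℕ∞ :=
  ringKrullDim (MvPolynomial σ ℂ ⧸ MvPolynomial.vanishingIdeal ℂ V)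

/-- A left ideal of the Weyl algebra in `m` variables is holonomic when its characteristic variety
has dimension `m`. -/
def Weyl.IsHolonomic {m : ℕ} (I : Ideal (Weyl m)) : Prop :=
  algebraicSetDim (Weyl.charVariety I) = (m : WithBot ℕ∞)

/-- The Euler operator `θ_i = x_i ∂_i`. -/
def Weyl.theta {m : ℕ} (i : Fin m) : Weyl m := Weyl.x i * Weyl.d i

/-- The Lauricella operator
`ℓ_i = θ_i (θ_i + c_i - 1) - x_i (θ + a) (θ + b)`, where `θ = θ_1 + ⋯ + θ_m`. -/
def lauricellaOp {m : ℕ} (a b : ℂ) (c : Fin m → ℂ) (i : Fin m) : Weyl m :=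
  Weyl.theta i * (Weyl.theta i + algebraMap ℂ (Weyl m) (c i - 1)) -
    Weyl.x i * ((∑ j, Weyl.theta j) + algebraMap ℂ (Weyl m) a) *
      ((∑ j, Weyl.theta j) + algebraMap ℂ (Weyl m) b)

/-- The left ideal `I(m)` generated by the Lauricella operators `ℓ_1, …, ℓ_m`. -/
def lauricellaIdeal {m : ℕ} (a b : ℂ) (c : Fin m → ℂ) : Ideal (Weyl m) :=
  Ideal.span (Set.range (lauricellaOp a b c))

end

noncomputable section
open MvPolynomial

/-! Write `S = ∑ x_j ξ_j`. The dimension is bounded from both sides, and neither bound needs the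
full characteristic ideal.

Upper bound: the principal symbol of `ℓ_i` is `x_i (x_i ξ_i² - S²)`. On an irreducible component of
the common zeros, the function field is generated by `m` elements. If `S = 0`, each `i` has `x_i =
0` or `ξ_i = 0`. If `S ≠ 0`, put `t_i = S / ξ_i` where `x_i ≠ 0`; then `x_i = t_i²`, `ξ_i = S / t_i`
and `∑ t_i = 1`, so `S` replaces one of the `t_i` (`exists_adjoin_le_of_lauricella_symbols`).

Lower bound: the system has a nonzero formal power series solution `f` for all parameters
(`exists_powerSeries_solution`). Every element of `I(m)` kills `f`. One of order `0` acts as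
multiplication by a polynomial, hence is `0`; the symbols of all others vanish at `ξ = 0`. So the
characteristic variety contains the zero section, of dimension `m`
(`zeroSection_subset_charVariety`). -/

/-! ### Krull dimension bounded by the number of field generators -/

/-- Incomparability: contraction along an integral map is strictly monotone on primes. Injectivity
plays no role. -/
theorem ringKrullDim_le_of_isIntegral {R S : Type*} [CommRing R] [CommRing S] (f : R →+* S)
    (hf : f.IsIntegral) : ringKrullDim S ≤ ringKrullDim R := by
  algebraize [f]
  refine Order.krullDim_le_of_strictMono (PrimeSpectrum.comap f) fun p q hpq => ?_
  exact Ideal.IsIntegral.comap_lt_comap (R := R) (A := S) hpq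

/-- Noether normalization: `A` is integral over a polynomial ring in `s` variables, and `s` is at
most the transcendence degree because that ring embeds in `A`. -/
theorem ringKrullDim_le_of_trdeg_le {k A : Type*} [Field k] [CommRing A] [IsDomain A]
    [Algebra k A] [Algebra.FiniteType k A] {n : ℕ} (h : Algebra.trdeg k A ≤ n) :
    ringKrullDim A ≤ n := by
  obtain ⟨s, g, hinj, hint⟩ := exists_integral_inj_algHom_of_fg k A
  have hs : s ≤ n := by
    have h1 := lift_trdeg_le_of_injective g hinj
    rw [MvPolynomial.trdeg_of_isDomain] at h1
    have h2 := Cardinal.lift_le.2 h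
    have := h1.trans h2
    simpa using this
  refine (ringKrullDim_le_of_isIntegral g.toRingHom hint).trans ?_
  rw [MvPolynomial.ringKrullDim_of_isNoetherianRing, ringKrullDim_eq_zero_of_field, zero_add,
    Nat.card_fin]
  exact_mod_cast hs

/-- A chain of primes above `J` lies above its own smallest member, so only domains have to be
considered. -/
theorem ringKrullDim_quotient_le_of_forall_isPrime {R : Type*} [CommRing R] (J : Ideal R) (n : ℕ)
    (h : ∀ P : Ideal R, P.IsPrime → J ≤ P → ringKrullDim (R ⧸ P) ≤ n) :
    ringKrullDim (R ⧸ J) ≤ n := by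
  rw [ringKrullDim_quotient]
  refine iSup_le fun p => ?_
  refine le_trans ?_ (h p.head.1.asIdeal p.head.1.isPrime p.head.2)
  rw [ringKrullDim_quotient]
  exact Order.LTSeries.length_le_krullDim (⟨p.length, fun i => ⟨(p i).1, fun x hx =>
    (p.monotone (Fin.zero_le i) : p.head ≤ p i) hx⟩, p.step⟩ :
      LTSeries (PrimeSpectrum.zeroLocus (p.head.1.asIdeal : Set R)))

/-- A finitely generated domain that embeds into a field generated by `n` elements has
dimension at most `n`. -/
theorem ringKrullDim_le_of_adjoin_eq_top {k A K : Type*} [Field k] [CommRing A] [IsDomain A]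
    [Algebra k A] [Algebra.FiniteType k A] [Field K] [Algebra k K] (φ : A →ₐ[k] K)
    (hφ : Function.Injective φ) {n : ℕ} (f : Fin n → K)
    (hf : IntermediateField.adjoin k (Set.range f) = ⊤) : ringKrullDim A ≤ n := by
  refine ringKrullDim_le_of_trdeg_le (k := k) ?_
  open scoped IntermediateField.algebraAdjoinAdjoin in
  have halg : Algebra.IsAlgebraic (Algebra.adjoin k (Set.range f)) K := by
    have h1 : Algebra.IsAlgebraic (Algebra.adjoin k (Set.range f))
        (IntermediateField.adjoin k (Set.range f)) :=
      IsLocalization.isAlgebraic _ (nonZeroDivisors (Algebra.adjoin k (Set.range f)))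
    refine ⟨fun x => ?_⟩
    have hx : x ∈ IntermediateField.adjoin k (Set.range f) := hf ▸ IntermediateField.mem_top
    exact (h1.isAlgebraic ⟨x, hx⟩).algebraMap
  have h2 := Algebra.IsAlgebraic.trdeg_le_cardinalMk k (A := K) (Set.range f)
  have h3 : Cardinal.mk (Set.range f) ≤ n := by
    simpa using Cardinal.mk_range_le_lift (f := f)
  have h4 := (lift_trdeg_le_of_injective φ hφ).trans (Cardinal.lift_le.2 (h2.trans h3))
  simpa using h4

/-! ### Upper bound: the common zeros of the Lauricella symbols -/

open scoped Classical in
/-- The common zeros of the symbols `x_i (x_i ξ_i² - (∑ x_j ξ_j)²)` in a field form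
an `m`-parameter family. -/
theorem exists_adjoin_le_of_lauricella_symbols {k K : Type*} [Field k] [Field K] [Algebra k K]
    {m : ℕ} (x y : Fin m → K) (h : ∀ i, x i * (x i * y i ^ 2 - (∑ j, x j * y j) ^ 2) = 0) :
    ∃ f : Fin m → K, (∀ i, x i ∈ IntermediateField.adjoin k (Set.range f)) ∧
      ∀ i, y i ∈ IntermediateField.adjoin k (Set.range f) := by
  set S := ∑ j, x j * y j with hS
  have h' : ∀ i, x i ≠ 0 → x i * y i ^ 2 = S ^ 2 := fun i hi =>
    sub_eq_zero.1 ((mul_eq_zero.1 (h i)).resolve_left hi)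
  by_cases hS0 : S = 0
  · refine ⟨fun i => if x i = 0 then y i else x i, fun i => ?_, fun i => ?_⟩
    · by_cases hi : x i = 0
      · rw [hi]; exact zero_mem _
      · exact IntermediateField.subset_adjoin _ _ ⟨i, by simp [hi]⟩
    · by_cases hi : x i = 0
      · exact IntermediateField.subset_adjoin _ _ ⟨i, by simp [hi]⟩
      · have : y i = 0 := by simpa [hS0, hi] using h' i hi
        rw [this]; exact zero_mem _
  -- `j₀` is an index with `x j₀ ≠ 0`; its parameter slot is free to hold `S`, since `t_{j₀}` is
  -- recovered from `∑ t_i = 1`.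
  · obtain ⟨j₀, -, hj⟩ := Finset.exists_ne_zero_of_sum_ne_zero (hS ▸ hS0)
    have hj₀ : x j₀ ≠ 0 := left_ne_zero_of_mul hj
    have hy : ∀ i, x i ≠ 0 → y i ≠ 0 := fun i hi h0 => by
      have := h' i hi
      exact hS0 (by simpa [h0] using this.symm)
    let f : Fin m → K := fun i => if x i = 0 then y i else if i = j₀ then S else S / y i
    have hmem : ∀ i, f i ∈ IntermediateField.adjoin k (Set.range f) := fun i =>
      IntermediateField.subset_adjoin _ _ ⟨i, rfl⟩
    have hSm : S ∈ IntermediateField.adjoin k (Set.range f) := by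
      simpa [f, hj₀] using hmem j₀
    -- From `x_i y_i = S² / y_i = S t_i` one gets `S = S ∑ t_i`; then cancel `S`.
    have hsum : ∑ i, (if x i = 0 then 0 else S / y i) = 1 := by
      have : S * ∑ i, (if x i = 0 then 0 else S / y i) = S * 1 := by
        rw [Finset.mul_sum, mul_one]
        conv_rhs => rw [hS]
        refine Finset.sum_congr rfl fun i _ => ?_
        by_cases hi : x i = 0
        · simp [hi]
        · rw [if_neg hi, ← mul_div_assoc, div_eq_iff (hy i hi), ← sq, ← h' i hi]
          ring
      exact mul_left_cancel₀ hS0 this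
    have hne : ∀ i, i ≠ j₀ → (if x i = 0 then 0 else S / y i) ∈
        IntermediateField.adjoin k (Set.range f) := fun i hij => by
      by_cases hi : x i = 0
      · rw [if_pos hi]; exact zero_mem _
      · simpa [f, hi, hij] using hmem i
    have ht : ∀ i, x i ≠ 0 → S / y i ∈ IntermediateField.adjoin k (Set.range f) := by
      intro i hi
      by_cases hij : i = j₀
      · subst hij
        rw [← Finset.add_sum_erase _ _ (Finset.mem_univ i), if_neg hi] at hsum
        rw [eq_sub_of_add_eq hsum]
        exact sub_mem (one_mem _) (sum_mem fun l hl => hne l (Finset.ne_of_mem_erase hl))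
      · simpa [hi] using hne i hij
    refine ⟨f, fun i => ?_, fun i => ?_⟩
    · by_cases hi : x i = 0
      · rw [hi]; exact zero_mem _
      · have : x i = (S / y i) ^ 2 := by
          rw [div_pow, ← h' i hi, mul_div_cancel_right₀ _ (pow_ne_zero _ (hy i hi))]
        rw [this]
        exact pow_mem (ht i hi) _
    · by_cases hi : x i = 0
      · simpa [f, hi] using hmem i
      · have : y i = S / (S / y i) := by
          rw [div_div_cancel₀ hS0]
        rw [this]
        exact div_mem hSm (ht i hi)

/-- An ideal of `ℂ[x, ξ]` containing all `x_i (x_i ξ_i² - (∑ x_j ξ_j)²)` has dimension at most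
`m`. -/
theorem ringKrullDim_quotient_le_of_lauricella_symbols {m : ℕ}
    (J : Ideal (MvPolynomial (WIdx m) ℂ))
    (hJ : ∀ i, X (Sum.inl i) * (X (Sum.inl i) * X (Sum.inr i) ^ 2 -
      (∑ j, X (Sum.inl j) * X (Sum.inr j)) ^ 2) ∈ J) :
    ringKrullDim (MvPolynomial (WIdx m) ℂ ⧸ J) ≤ m := by
  -- Modulo a prime the equations hold in a fraction field, where the case distinctions and
  -- divisions make sense.
  refine ringKrullDim_quotient_le_of_forall_isPrime J m fun P hP hJP => ?_
  let A := MvPolynomial (WIdx m) ℂ ⧸ P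
  let K := FractionRing A
  let φ : A →ₐ[ℂ] K := IsScalarTower.toAlgHom ℂ A K
  have hφ : Function.Injective φ := IsFractionRing.injective A K
  let ψ : MvPolynomial (WIdx m) ℂ →ₐ[ℂ] K := φ.comp (Ideal.Quotient.mkₐ ℂ P)
  obtain ⟨f, hx, hy⟩ := exists_adjoin_le_of_lauricella_symbols (k := ℂ)
    (fun i => ψ (X (Sum.inl i))) (fun i => ψ (X (Sum.inr i))) (fun i => by
      have h1 : Ideal.Quotient.mkₐ ℂ P _ = 0 := Ideal.Quotient.eq_zero_iff_mem.2 (hJP (hJ i))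
      have h2 : ψ _ = 0 := (congrArg φ h1).trans (map_zero φ)
      simpa only [map_mul, map_sub, map_pow, map_sum] using h2)
  refine ringKrullDim_le_of_adjoin_eq_top φ hφ f (top_le_iff.1 fun z _ => ?_)
  have hψ : ∀ p, ψ p ∈ IntermediateField.adjoin ℂ (Set.range f) := by
    intro p
    induction p using MvPolynomial.induction_on with
    | C a =>
      rw [← MvPolynomial.algebraMap_eq, AlgHom.commutes]
      exact IntermediateField.algebraMap_mem _ a
    | add p q hp hq => rw [map_add]; exact add_mem hp hq
    | mul_X p i hp =>
      rw [map_mul]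
      refine mul_mem hp ?_
      rcases i with i | i
      exacts [hx i, hy i]
  obtain ⟨u, v, -, rfl⟩ := IsFractionRing.div_surjective (A := A) z
  obtain ⟨p, rfl⟩ := Ideal.Quotient.mk_surjective u
  obtain ⟨q, rfl⟩ := Ideal.Quotient.mk_surjective v
  exact div_mem (hψ p) (hψ q)

end
-- Principal symbols of the Lauricella operators
noncomputable section
open MvPolynomial

namespace Weyl

variable {m : ℕ}

/-- This makes symbols computable: let the operator act on `1`. -/
theorem fullSymbol_eq (P : Weyl m) : fullSymbol P = symbolAction m P 1 := by
  rw [fullSymbol, LinearEquiv.symm_apply_eq]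
  change P = normalOrder m _
  rw [normalOrder_symbolAction, normalOrder_one, mul_one]

/-- The principal symbol of an operator whose full symbol is a sum of homogeneous parts of degree
`2`, `1` and `0`. -/
theorem principalSymbol_of_fullSymbol_eq {P : Weyl m} {p₂ p₁ p₀ : MvPolynomial (WIdx m) ℂ}
    (h : fullSymbol P = p₂ + p₁ + p₀) (h₂ : IsWeightedHomogeneous (weight01 m) p₂ 2)
    (h₁ : IsWeightedHomogeneous (weight01 m) p₁ 1) (h₀ : IsWeightedHomogeneous (weight01 m) p₀ 0)
    (hne : p₂ ≠ 0) : principalSymbol P = p₂ := by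
  have hord : order P = 2 := by
    refine le_antisymm (Finset.sup_le fun d hd => ?_) ?_
    · by_contra! hlt
      rw [mem_support_iff, h, coeff_add, coeff_add, h₂.coeff_eq_zero d (by omega),
        h₁.coeff_eq_zero d (by omega), h₀.coeff_eq_zero d (by omega)] at hd
      simp at hd
    · obtain ⟨d, hd⟩ := MvPolynomial.ne_zero_iff.1 hne
      have hw := h₂ hd
      rw [order, ← hw]
      refine le_weightedTotalDegree _ ?_
      rw [mem_support_iff, h, coeff_add, coeff_add, h₁.coeff_eq_zero d (by omega),
        h₀.coeff_eq_zero d (by omega)]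
      simpa using hd
  rw [principalSymbol, hord, h, map_add, map_add, h₂.weightedHomogeneousComponent_same,
    h₁.weightedHomogeneousComponent_ne 2 (by norm_num),
    h₀.weightedHomogeneousComponent_ne 2 (by norm_num), add_zero, add_zero]

theorem symbolAction_theta (i : Fin m) (p : MvPolynomial (WIdx m) ℂ) :
    symbolAction m (theta i) p =
      X (Sum.inl i) * (X (Sum.inr i) * p + pderiv (Sum.inl i) p) := by
  rw [theta, map_mul, Module.End.mul_apply, symbolAction_d, symbolAction_x]

theorem pderiv_inl_euler (j : Fin m) :
    pderiv (Sum.inl j) (∑ k, X (Sum.inl k) * X (Sum.inr k) : MvPolynomial (WIdx m) ℂ) =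
      X (Sum.inr j) := by
  simp [pderiv_X, Pi.single_apply, Derivation.leibniz]

/-- `θ` acts as multiplication by `S` plus the Euler derivation in `x`, which fixes `S`. Polynomials
of this shape are what `θ + b` makes of `1`, so two uses give `(θ + a)(θ + b)`. -/
theorem symbolAction_euler_add (s a : ℂ) (t : ℂ) :
    symbolAction m ((∑ j, theta j) + algebraMap ℂ (Weyl m) a)
      (C t * (∑ k, X (Sum.inl k) * X (Sum.inr k)) + C s) =
      C t * (∑ k, X (Sum.inl k) * X (Sum.inr k)) ^ 2 +
        C (s + t + a * t) * (∑ k, X (Sum.inl k) * X (Sum.inr k)) + C (a * s) := by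
  rw [map_add (symbolAction m), map_sum, AlgHom.commutes, LinearMap.add_apply,
    LinearMap.sum_apply, Module.algebraMap_end_apply]
  simp only [symbolAction_theta, map_add, Derivation.leibniz, pderiv_inl_euler, pderiv_C,
    add_zero, smul_eq_mul, mul_add, Finset.sum_add_distrib, MvPolynomial.smul_eq_C_mul]
  have h1 : ∀ q : MvPolynomial (WIdx m) ℂ, ∑ x, X (Sum.inl x) * (X (Sum.inr x) * q) =
      (∑ k, X (Sum.inl k) * X (Sum.inr k)) * q := fun q => by
    rw [Finset.sum_mul]
    exact Finset.sum_congr rfl fun _ _ => (mul_assoc _ _ _).symm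
  have h2 : ∑ x, X (Sum.inl x) * (C t * X (Sum.inr x)) =
      (∑ k, X (Sum.inl k) * X (Sum.inr k) : MvPolynomial (WIdx m) ℂ) * C t := by
    rw [Finset.sum_mul]
    exact Finset.sum_congr rfl fun _ _ => by ring
  simp only [h1, h2, mul_zero, Finset.sum_const_zero, map_mul, add_zero]
  ring

theorem fullSymbol_lauricellaOp (a b : ℂ) (c : Fin m → ℂ) (i : Fin m) :
    fullSymbol (lauricellaOp a b c i) =
      X (Sum.inl i) * (X (Sum.inl i) * X (Sum.inr i) ^ 2 -
        (∑ j, X (Sum.inl j) * X (Sum.inr j)) ^ 2) +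
      (C (c i) * (X (Sum.inl i) * X (Sum.inr i)) -
        X (Sum.inl i) * (C (1 + a + b) * ∑ j, X (Sum.inl j) * X (Sum.inr j))) +
      -(X (Sum.inl i) * C (a * b)) := by
  have hb := symbolAction_euler_add (m := m) 1 b 0
  have ha := symbolAction_euler_add (m := m) b a 1
  simp only [map_zero, zero_mul, zero_add, mul_zero, add_zero, map_one, mul_one, one_mul] at ha hb
  rw [fullSymbol_eq, lauricellaOp, map_sub, LinearMap.sub_apply]
  simp only [map_mul, Module.End.mul_apply]
  rw [hb, ha, symbolAction_x, map_add, LinearMap.add_apply, AlgHom.commutes,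
    Module.algebraMap_end_apply]
  simp only [symbolAction_theta, map_add, Derivation.leibniz, pderiv_X, MvPolynomial.smul_eq_C_mul,
    pderiv_C, map_one, map_sub]
  simp
  ring

theorem isWeightedHomogeneous_X_inl (i : Fin m) :
    IsWeightedHomogeneous (weight01 m) (X (Sum.inl i) : MvPolynomial (WIdx m) ℂ) 0 :=
  isWeightedHomogeneous_X ℂ (weight01 m) (Sum.inl i)

theorem isWeightedHomogeneous_X_inr (i : Fin m) :
    IsWeightedHomogeneous (weight01 m) (X (Sum.inr i) : MvPolynomial (WIdx m) ℂ) 1 :=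
  isWeightedHomogeneous_X ℂ (weight01 m) (Sum.inr i)

theorem principalSymbol_lauricellaOp (a b : ℂ) (c : Fin m → ℂ) (i : Fin m) :
    principalSymbol (lauricellaOp a b c i) =
      X (Sum.inl i) * (X (Sum.inl i) * X (Sum.inr i) ^ 2 -
        (∑ j, X (Sum.inl j) * X (Sum.inr j)) ^ 2) := by
  have hxy : ∀ j, IsWeightedHomogeneous (weight01 m)
      (X (Sum.inl j) * X (Sum.inr j) : MvPolynomial (WIdx m) ℂ) 1 := fun j => by
    simpa using (isWeightedHomogeneous_X_inl j).mul (isWeightedHomogeneous_X_inr j)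
  have hS : IsWeightedHomogeneous (weight01 m)
      (∑ j, X (Sum.inl j) * X (Sum.inr j) : MvPolynomial (WIdx m) ℂ) 1 :=
    IsWeightedHomogeneous.sum _ _ _ fun j _ => hxy j
  refine principalSymbol_of_fullSymbol_eq (fullSymbol_lauricellaOp a b c i) ?_ ?_ ?_ ?_
  · have h1 : IsWeightedHomogeneous (weight01 m)
        (X (Sum.inl i) * X (Sum.inr i) ^ 2 : MvPolynomial (WIdx m) ℂ) 2 := by
      simpa using (isWeightedHomogeneous_X_inl i).mul ((isWeightedHomogeneous_X_inr i).pow 2)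
    have h2 := h1.sub (by simpa using hS.pow 2)
    simpa using (isWeightedHomogeneous_X_inl i).mul h2
  · refine ((hxy i).C_mul _).sub ?_
    simpa using (isWeightedHomogeneous_X_inl i).mul (hS.C_mul (1 + a + b))
  · rw [← mem_weightedHomogeneousSubmodule]
    refine neg_mem ?_
    rw [mem_weightedHomogeneousSubmodule]
    simpa using (isWeightedHomogeneous_X_inl i).mul (isWeightedHomogeneous_C (weight01 m) (a * b))
  · intro h0
    -- At `x_i = 2`, `ξ_i = 1`, all else `0`, the value is `2 (2 - 4) = -4`; `x_i = 1` would give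
    -- `0`.
    have h := congrArg (eval (Sum.elim (Pi.single i 2) (Pi.single i 1))) h0
    simp [Pi.single_apply] at h
    norm_num at h

end Weyl
end
-- The Weyl algebra acting on formal power series
noncomputable section

namespace Weyl

variable {m : ℕ}

theorem coeff_X_mul (n : Fin m →₀ ℕ) (i : Fin m) (f : MvPowerSeries (Fin m) ℂ) :
    MvPowerSeries.coeff n (MvPowerSeries.X i * f) =
      if n i = 0 then 0 else MvPowerSeries.coeff (n - Finsupp.single i 1) f := by
  rw [MvPowerSeries.X, MvPowerSeries.coeff_monomial_mul, one_mul]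
  by_cases h : n i = 0
  · rw [if_pos h, if_neg (by rw [Finsupp.single_le_iff]; omega)]
  · rw [if_neg h, if_pos (by rw [Finsupp.single_le_iff]; omega)]

theorem pderiv_comm (i j : Fin m) (f : MvPowerSeries (Fin m) ℂ) :
    MvPowerSeries.pderiv ℂ i (MvPowerSeries.pderiv ℂ j f) =
      MvPowerSeries.pderiv ℂ j (MvPowerSeries.pderiv ℂ i f) := by
  ext n
  by_cases hij : i = j
  · rw [hij]
  · simp only [MvPowerSeries.coeff_pderiv, Finsupp.add_apply, Finsupp.single_apply, hij,
      Ne.symm hij, if_false, add_zero]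
    rw [add_right_comm]
    ring

/-- The operators by which `x_j` and `∂_j` act on formal power series. -/
def powerSeriesGen (m : ℕ) : WIdx m → Module.End ℂ (MvPowerSeries (Fin m) ℂ)
  | Sum.inl j => LinearMap.mulLeft ℂ (MvPowerSeries.X j)
  | Sum.inr j => (MvPowerSeries.pderiv ℂ j).toLinearMap

/-- The action of the Weyl algebra on formal power series. -/
def powerSeriesAction (m : ℕ) : Weyl m →ₐ[ℂ] Module.End ℂ (MvPowerSeries (Fin m) ℂ) :=
  RingQuot.liftAlgHom ℂ ⟨FreeAlgebra.lift ℂ (powerSeriesGen m), by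
    rintro _ _ (⟨i, j⟩ | ⟨i, j⟩ | ⟨i, j⟩)
    · simp only [map_mul, FreeAlgebra.lift_ι_apply]
      refine LinearMap.ext fun f => ?_
      simp [powerSeriesGen, mul_left_comm]
    · simp only [map_mul, FreeAlgebra.lift_ι_apply]
      exact LinearMap.ext fun f => pderiv_comm i j f
    · simp only [map_mul, map_add, FreeAlgebra.lift_ι_apply]
      refine LinearMap.ext fun f => ?_
      by_cases hij : i = j
      · subst hij
        simp [powerSeriesGen]
      · simp [powerSeriesGen, hij, MvPowerSeries.pderiv_X_of_ne (Ne.symm hij)]⟩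

theorem powerSeriesAction_mk (f : FreeAlgebra ℂ (WIdx m)) :
    powerSeriesAction m (mk m f) = FreeAlgebra.lift ℂ (powerSeriesGen m) f :=
  RingQuot.liftAlgHom_mkAlgHom_apply ℂ _ _ _

theorem powerSeriesAction_x (j : Fin m) (f : MvPowerSeries (Fin m) ℂ) :
    powerSeriesAction m (x j) f = MvPowerSeries.X j * f := by
  rw [x, powerSeriesAction_mk, FreeAlgebra.lift_ι_apply]
  rfl

theorem powerSeriesAction_d (j : Fin m) (f : MvPowerSeries (Fin m) ℂ) :
    powerSeriesAction m (d j) f = MvPowerSeries.pderiv ℂ j f := by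
  rw [d, powerSeriesAction_mk, FreeAlgebra.lift_ι_apply]
  rfl

/-- Monomials are eigenvectors of `θ_i`, which turns the differential system into a recursion on
coefficients. -/
theorem coeff_powerSeriesAction_theta (i : Fin m) (f : MvPowerSeries (Fin m) ℂ)
    (n : Fin m →₀ ℕ) :
    MvPowerSeries.coeff n (powerSeriesAction m (theta i) f) =
      n i * MvPowerSeries.coeff n f := by
  rw [theta, map_mul, Module.End.mul_apply, powerSeriesAction_d, powerSeriesAction_x, coeff_X_mul]
  by_cases h : n i = 0
  · simp [h]
  · have hle : Finsupp.single i 1 ≤ n := by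
      rw [Finsupp.single_le_iff]
      omega
    rw [if_neg h, MvPowerSeries.coeff_pderiv, tsub_add_cancel_of_le hle, Finsupp.tsub_apply,
      Finsupp.single_eq_same, Nat.cast_sub (by omega)]
    push_cast
    ring

theorem coeff_powerSeriesAction_theta_add (i : Fin m) (t : ℂ) (f : MvPowerSeries (Fin m) ℂ)
    (n : Fin m →₀ ℕ) :
    MvPowerSeries.coeff n (powerSeriesAction m (theta i + algebraMap ℂ (Weyl m) t) f) =
      (n i + t) * MvPowerSeries.coeff n f := by
  rw [map_add, LinearMap.add_apply, map_add, coeff_powerSeriesAction_theta, AlgHom.commutes,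
    Module.algebraMap_end_apply, map_smul, smul_eq_mul, add_mul]

theorem coeff_powerSeriesAction_euler_add (t : ℂ) (f : MvPowerSeries (Fin m) ℂ)
    (n : Fin m →₀ ℕ) :
    MvPowerSeries.coeff n
        (powerSeriesAction m ((∑ j, theta j) + algebraMap ℂ (Weyl m) t) f) =
      ((∑ j, n j : ℕ) + t) * MvPowerSeries.coeff n f := by
  rw [map_add (powerSeriesAction m), LinearMap.add_apply, map_add, map_sum (powerSeriesAction m),
    LinearMap.sum_apply, map_sum, AlgHom.commutes, Module.algebraMap_end_apply, map_smul,
    smul_eq_mul, add_mul, Nat.cast_sum, Finset.sum_mul]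
  simp only [coeff_powerSeriesAction_theta]

/-- The recursion on coefficients for formal power series solutions of the Lauricella system. -/
theorem powerSeriesAction_lauricellaOp_eq_zero (a b : ℂ) (c : Fin m → ℂ) (i : Fin m)
    (f : MvPowerSeries (Fin m) ℂ)
    (h : ∀ n : Fin m →₀ ℕ, ((n i : ℂ) + 1) * (n i + c i) *
      MvPowerSeries.coeff (n + Finsupp.single i 1) f =
        ((∑ j, n j : ℕ) + a) * ((∑ j, n j : ℕ) + b) * MvPowerSeries.coeff n f) :
    powerSeriesAction m (lauricellaOp a b c i) f = 0 := by
  ext n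
  rw [lauricellaOp, map_sub, LinearMap.sub_apply, map_sub]
  simp only [map_mul, Module.End.mul_apply]
  rw [coeff_powerSeriesAction_theta, coeff_powerSeriesAction_theta_add, powerSeriesAction_x,
    coeff_X_mul]
  -- If `n i = 0`, both terms vanish: the first carries the factor `n i`, the second is divisible by
  -- `X i`. Otherwise the recursion applies at `n` lowered by one in direction `i`.
  by_cases hn : n i = 0
  · simp [hn]
  · obtain ⟨k, rfl⟩ : ∃ k, n = k + Finsupp.single i 1 :=
      ⟨n - Finsupp.single i 1, (tsub_add_cancel_of_le (by
        rw [Finsupp.single_le_iff]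
        omega)).symm⟩
    rw [if_neg hn, add_tsub_cancel_right, coeff_powerSeriesAction_euler_add,
      coeff_powerSeriesAction_euler_add, ← mul_assoc ((∑ j, k j : ℕ) + a), ← h k]
    simp
    ring

end Weyl

/-! ### A formal solution for arbitrary parameters -/

/-- The coefficients `1 / ((k)! (c)_k)`, normalised to start at `k = s`. -/
def shiftedCoeff (c : ℂ) (s k : ℕ) : ℂ :=
  if k < s then 0 else ∏ j ∈ Finset.Ico s k, (((j : ℂ) + 1) * (j + c))⁻¹

theorem shiftedCoeff_self (c : ℂ) (s : ℕ) : shiftedCoeff c s s = 1 := by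
  simp [shiftedCoeff]

/-- The recursion is delicate only at two places. At `k + 1 = s` the coefficient jumps from `0` to
`1`, so the left factor must vanish; for `k ≥ s` that factor must be invertible. -/
theorem shiftedCoeff_succ (c : ℂ) (s k : ℕ) (h₁ : k + 1 = s → (k : ℂ) + c = 0)
    (h₂ : s ≤ k → (k : ℂ) + c ≠ 0) :
    ((k : ℂ) + 1) * (k + c) * shiftedCoeff c s (k + 1) = shiftedCoeff c s k := by
  rcases lt_trichotomy (k + 1) s with h | h | h
  · simp [shiftedCoeff, h, (Nat.lt_succ_self k).trans h]
  · rw [h₁ h]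
    simp [shiftedCoeff, show k < s by omega]
  · have hk : ((k : ℂ) + 1) * (k + c) ≠ 0 :=
      mul_ne_zero (Nat.cast_add_one_ne_zero k) (h₂ (by omega))
    rw [shiftedCoeff, shiftedCoeff, if_neg (by omega), if_neg (by omega),
      Finset.prod_Ico_succ_top (by omega), mul_comm, mul_assoc, inv_mul_cancel₀ hk, mul_one]

/-- The product of Pochhammer symbols `(a)_N (b)_N`. -/
def pochhammerPair (a b : ℂ) (N : ℕ) : ℂ := ∏ j ∈ Finset.range N, ((j + a) * (j + b))

theorem pochhammerPair_succ (a b : ℂ) (N : ℕ) :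
    pochhammerPair a b (N + 1) = (N + a) * (N + b) * pochhammerPair a b N := by
  rw [pochhammerPair, Finset.prod_range_succ, mul_comm]
  rfl

theorem pochhammerPair_eq_zero_of_le {a b : ℂ} {N M : ℕ} (h : N ≤ M)
    (hN : pochhammerPair a b N = 0) : pochhammerPair a b M = 0 := by
  induction M, h using Nat.le_induction with
  | base => exact hN
  | succ M _ ih => rw [pochhammerPair_succ, ih, mul_zero]

/-- The starting exponents of a formal power series solution: `s i` is `0` or `1 - c_i`, and no
further exponent can be raised. -/
theorem exists_lauricella_exponents {m : ℕ} (a b : ℂ) (c : Fin m → ℂ) :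
    ∃ s : Fin m → ℕ, pochhammerPair a b (∑ i, s i) ≠ 0 ∧
      ∀ i, (s i = 0 ∨ (s i : ℂ) = 1 - c i) ∧ ∀ k : ℕ, s i ≤ k → (k : ℂ) + c i = 0 →
        pochhammerPair a b ((∑ i, s i) + (k + 1)) = 0 := by
  classical
  -- At most one `k` satisfies `k + c_i = 0`; when there is none, `K i` is a dummy.
  have hκ : ∀ i, ∃ K : ℕ, ∀ k : ℕ, (k : ℂ) + c i = 0 → k = K := fun i => by
    by_cases h : ∃ K : ℕ, (K : ℂ) + c i = 0
    · obtain ⟨K, hK⟩ := h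
      exact ⟨K, fun k hk => by exact_mod_cast add_right_cancel (hk.trans hK.symm)⟩
    · exact ⟨0, fun k hk => absurd ⟨k, hk⟩ h⟩
  choose K hK using hκ
  -- `T` collects the indices whose starting exponent is raised from `0` to `K i + 1 = 1 - c_i`. A
  -- maximal `T` with nonzero Pochhammer factor is taken.
  let Q : Finset (Fin m) → Prop := fun T => (∀ i ∈ T, (K i : ℂ) + c i = 0) ∧
    pochhammerPair a b (∑ i ∈ T, (K i + 1)) ≠ 0
  obtain ⟨T, hT, hmax⟩ := (Set.toFinite {T | Q T}).exists_maximal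
    ⟨∅, by simp [Q, pochhammerPair]⟩
  have hsum : ∑ i, (if i ∈ T then K i + 1 else 0) = ∑ i ∈ T, (K i + 1) := by
    simp [Finset.sum_ite_mem]
  refine ⟨fun i => if i ∈ T then K i + 1 else 0, by simpa only [hsum] using hT.2,
    fun i => ⟨?_, fun k hk hkc => ?_⟩⟩
  · by_cases hi : i ∈ T
    · right
      have := hT.1 i hi
      simp only [hi, if_true, Nat.cast_add, Nat.cast_one]
      linear_combination this
    · left
      simp [hi]
  · obtain rfl := hK i k hkc
    rw [hsum]
    by_contra hne
    by_cases hi : i ∈ T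
    · simp [hi] at hk
    -- Were the factor nonzero, `insert i T` would also be admissible, against maximality.
    · refine hi (hmax (y := insert i T) ⟨?_, ?_⟩ (Finset.subset_insert i T)
        (Finset.mem_insert_self i T))
      · intro j hj
        rcases Finset.mem_insert.1 hj with rfl | hj
        exacts [hkc, hT.1 j hj]
      · rwa [Finset.sum_insert hi, add_comm]

/-- The Lauricella system has a nonzero formal power series solution, for all parameters. -/
theorem exists_powerSeries_solution {m : ℕ} (a b : ℂ) (c : Fin m → ℂ) :
    ∃ f : MvPowerSeries (Fin m) ℂ, f ≠ 0 ∧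
      ∀ i, Weyl.powerSeriesAction m (lauricellaOp a b c i) f = 0 := by
  obtain ⟨s, hs, hs'⟩ := exists_lauricella_exponents a b c
  -- The Lauricella series with its support moved to start at `s`; its coefficient at `s` is the
  -- nonzero Pochhammer factor.
  let f : MvPowerSeries (Fin m) ℂ := fun n =>
    pochhammerPair a b (∑ i, n i) * ∏ i, shiftedCoeff (c i) (s i) (n i)
  have hf : ∀ n, MvPowerSeries.coeff n f =
    pochhammerPair a b (∑ i, n i) * ∏ i, shiftedCoeff (c i) (s i) (n i) := fun n => rfl
  refine ⟨f, fun h0 => hs ?_, fun i =>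
    Weyl.powerSeriesAction_lauricellaOp_eq_zero a b c i f fun n => ?_⟩
  · have := hf (Finsupp.equivFunOnFinite.symm s)
    simpa [h0, shiftedCoeff_self] using this.symm
  · have hsum : ∑ j, (n + Finsupp.single i 1 : Fin m →₀ ℕ) j = (∑ j, n j) + 1 := by
      simp [Finset.sum_add_distrib, Finsupp.single_apply]
    have hprod : ∏ j ∈ Finset.univ.erase i,
        shiftedCoeff (c j) (s j) ((n + Finsupp.single i 1 : Fin m →₀ ℕ) j) =
        ∏ j ∈ Finset.univ.erase i, shiftedCoeff (c j) (s j) (n j) := by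
      refine Finset.prod_congr rfl fun j hj => ?_
      simp [Finsupp.single_eq_of_ne (Finset.ne_of_mem_erase hj)]
    rw [hf, hf, hsum, ← mul_assoc ((((∑ j, n j : ℕ) : ℂ) + a) * _), ← pochhammerPair_succ,
      ← Finset.mul_prod_erase _ _ (Finset.mem_univ i),
      ← Finset.mul_prod_erase _ _ (Finset.mem_univ i), hprod, Finsupp.add_apply,
      Finsupp.single_eq_same]
    -- In the critical case the left side of the recursion is `0`, so the right side must vanish
    -- too: either some other exponent is below its start, or the Pochhammer factor is zero.
    by_cases hcrit : s i ≤ n i ∧ (n i : ℂ) + c i = 0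
    · rw [hcrit.2]
      by_cases hlt : ∃ j ∈ Finset.univ.erase i, n j < s j
      · obtain ⟨j, hj, hlt⟩ := hlt
        rw [Finset.prod_eq_zero hj (show shiftedCoeff (c j) (s j) (n j) = 0 by
          simp [shiftedCoeff, hlt])]
        simp
      · push Not at hlt
        -- The alternative `s i = 1 - c i` would give `s i = n i + 1 > n i`. With `s i = 0`, the
        -- total degree `∑ n_j + 1` reaches the range where the Pochhammer factor vanishes.
        have hs0 : s i = 0 := by
          refine (hs' i).1.resolve_right fun h => ?_
          have h1 : ((n i : ℕ) : ℂ) + 1 = (s i : ℕ) := by linear_combination hcrit.2 - h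
          have h2 : n i + 1 = s i := by exact_mod_cast h1
          omega
        have hle : (∑ j, s j) + (n i + 1) ≤ (∑ j, n j) + 1 := by
          have h1 := Finset.sum_le_sum hlt
          have h2 := Finset.add_sum_erase Finset.univ s (Finset.mem_univ i)
          have h3 := Finset.add_sum_erase Finset.univ n (Finset.mem_univ i)
          omega
        rw [pochhammerPair_eq_zero_of_le hle ((hs' i).2 _ hcrit.1 hcrit.2)]
        simp
    · have := shiftedCoeff_succ (c i) (s i) (n i) (fun h => by
        have h1 : (s i : ℂ) = 1 - c i := (hs' i).1.resolve_left (by omega)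
        have h2 : ((n i : ℕ) : ℂ) + 1 = (s i : ℕ) := by exact_mod_cast h
        linear_combination h1 + h2) (fun h h0 => hcrit ⟨h, h0⟩)
      rw [← this]
      ring

end
-- Lower bound: the zero section lies in the characteristic variety
noncomputable section
open MvPolynomial

namespace Weyl

variable {m : ℕ}

theorem powerSeriesAction_normalOrder_rename (q : MvPolynomial (Fin m) ℂ)
    (f : MvPowerSeries (Fin m) ℂ) :
    powerSeriesAction m (normalOrder m (rename Sum.inl q)) f = (q : MvPowerSeries (Fin m) ℂ) * f := by
  induction q using MvPolynomial.induction_on with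
  | C t =>
    rw [rename_C, ← mul_one (C t), ← MvPolynomial.smul_eq_C_mul, map_smul, normalOrder_one,
      map_smul, map_one, MvPolynomial.coe_C, LinearMap.smul_apply,
      Module.End.one_apply, MvPowerSeries.smul_eq_C_mul]
  | add p q hp hq =>
    rw [map_add, map_add, map_add, LinearMap.add_apply, hp, hq, MvPolynomial.coe_add, add_mul]
  | mul_X p i hp =>
    rw [map_mul, rename_X, mul_comm, ← x_mul_normalOrder, map_mul, Module.End.mul_apply, hp,
      powerSeriesAction_x, MvPolynomial.coe_mul, MvPolynomial.coe_X]
    ring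

theorem exists_fullSymbol_eq_rename {P : Weyl m} (h : order P = 0) :
    ∃ q : MvPolynomial (Fin m) ℂ, rename Sum.inl q = fullSymbol P := by
  refine ⟨_, (exists_rename_eq_of_vars_subset_range (fullSymbol P) (Sum.inl : Fin m → WIdx m)
    Sum.inl_injective ?_).choose_spec⟩
  intro k hk
  obtain ⟨s, hs, hks⟩ := (mem_vars_iff_mem_support k).1 hk
  rcases k with k | k
  · exact ⟨k, rfl⟩
  · exfalso
    have h1 := (le_weightedTotalDegree (weight01 m) hs).trans h.le
    have h2 := Finsupp.le_weight (weight01 m) (s := Sum.inr k) (by simp [weight01]) s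
    rw [Finsupp.mem_support_iff] at hks
    omega

/-- An operator of order `0` contains no `∂_i`, so it multiplies by a polynomial, and power series
over `ℂ` form a domain. The convention that `0` has order `0` is harmless here. -/
theorem eq_zero_of_order_eq_zero {P : Weyl m} (h : order P = 0) {f : MvPowerSeries (Fin m) ℂ}
    (hf : f ≠ 0) (hP : powerSeriesAction m P f = 0) : P = 0 := by
  obtain ⟨q, hq⟩ := exists_fullSymbol_eq_rename h
  have hPq : P = normalOrder m (rename Sum.inl q) := by
    rw [hq]
    exact ((normalOrderEquiv m).apply_symm_apply P).symm
  rw [hPq, powerSeriesAction_normalOrder_rename] at hP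
  have hq0 : q = 0 := by
    have := (mul_eq_zero.1 hP).resolve_right hf
    exact MvPolynomial.coe_injective (Fin m) ℂ (by simpa using this)
  rw [hPq, hq0, map_zero, map_zero]

/-- Each monomial of positive weight contains some `ξ_i`. -/
theorem aeval_eq_zero_of_isWeightedHomogeneous {p : MvPolynomial (WIdx m) ℂ} {n : ℕ}
    (hn : n ≠ 0) (hp : IsWeightedHomogeneous (weight01 m) p n) (v : Fin m → ℂ) :
    aeval (Sum.elim v 0 : WIdx m → ℂ) p = 0 := by
  rw [aeval_def, eval₂_eq']
  refine Finset.sum_eq_zero fun s hs => ?_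
  have hw := hp (mem_support_iff.1 hs)
  obtain ⟨i, hi⟩ : ∃ i : Fin m, s (Sum.inr i) ≠ 0 := by
    by_contra! hcon
    refine hn (hw.symm.trans ?_)
    rw [Finsupp.weight_apply, Finsupp.sum_fintype _ _ (by simp), Fintype.sum_sum_type]
    simp [weight01, hcon]
  rw [Finset.prod_eq_zero (Finset.mem_univ (Sum.inr i : WIdx m)) (by simp [hi]), mul_zero]

/-- If `D / I` has a nonzero formal power series solution then `Ch(I)` contains the zero section. -/
theorem zeroSection_subset_charVariety {I : Ideal (Weyl m)} {f : MvPowerSeries (Fin m) ℂ}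
    (hf : f ≠ 0) (hI : ∀ P ∈ I, powerSeriesAction m P f = 0) (v : Fin m → ℂ) :
    (Sum.elim v 0 : WIdx m → ℂ) ∈ charVariety I := by
  rw [charVariety, charIdeal, zeroLocus_span]
  rintro _ ⟨P, hP, rfl⟩
  by_cases h : order P = 0
  · rw [eq_zero_of_order_eq_zero h hf (hI P hP)]
    simp [principalSymbol, fullSymbol]
  · exact aeval_eq_zero_of_isWeightedHomogeneous h
      (weightedHomogeneousComponent_isWeightedHomogeneous _ _) v

theorem powerSeriesAction_eq_zero_of_mem_span {S : Set (Weyl m)} {f : MvPowerSeries (Fin m) ℂ}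
    (hS : ∀ P ∈ S, powerSeriesAction m P f = 0) {P : Weyl m} (hP : P ∈ Ideal.span S) :
    powerSeriesAction m P f = 0 := by
  induction hP using Submodule.span_induction with
  | mem P hP => exact hS P hP
  | zero => rw [map_zero, LinearMap.zero_apply]
  | add P Q _ _ hP hQ => rw [map_add, LinearMap.add_apply, hP, hQ, add_zero]
  | smul Q P _ hP => rw [smul_eq_mul, map_mul, Module.End.mul_apply, hP, map_zero]

end Weyl

/-- Setting `ξ = 0` maps the coordinate ring of `V` onto `ℂ[x]`: it is well defined because a
polynomial vanishing at every point of `ℂ^m` is zero. -/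
theorem le_algebraicSetDim_of_zeroSection_subset {m : ℕ} {V : Set (WIdx m → ℂ)}
    (hV : ∀ v : Fin m → ℂ, (Sum.elim v 0 : WIdx m → ℂ) ∈ V) :
    (m : WithBot ℕ∞) ≤ algebraicSetDim V := by
  let φ : MvPolynomial (WIdx m) ℂ →ₐ[ℂ] MvPolynomial (Fin m) ℂ := aeval (Sum.elim X 0)
  have hker : ∀ p ∈ vanishingIdeal ℂ V, φ p = 0 := fun p hp => by
    refine MvPolynomial.funext fun v => ?_
    have h1 : (aeval v).comp φ = aeval (Sum.elim v 0 : WIdx m → ℂ) := by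
      refine MvPolynomial.algHom_ext fun k => ?_
      rcases k with k | k <;> simp [φ]
    have h2 := DFunLike.congr_fun h1 p
    rw [map_zero, ← MvPolynomial.coe_aeval_eq_eval]
    exact h2.trans (hp _ (hV v))
  have hsurj : Function.Surjective (Ideal.Quotient.lift (vanishingIdeal ℂ V) φ.toRingHom hker) :=
    fun q => ⟨Ideal.Quotient.mk _ (rename Sum.inl q), by
      refine (Ideal.Quotient.lift_mk _ _ _).trans ?_
      change φ (rename Sum.inl q) = q
      rw [aeval_rename, Sum.elim_comp_inl, aeval_X_left_apply]⟩
  have h := ringKrullDim_le_of_surjective _ hsurj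
  rwa [MvPolynomial.ringKrullDim_of_isNoetherianRing, ringKrullDim_eq_zero_of_field, zero_add,
    Nat.card_fin] at h

theorem algebraicSetDim_charVariety_lauricellaIdeal {m : ℕ} (a b : ℂ) (c : Fin m → ℂ) :
    algebraicSetDim (Weyl.charVariety (lauricellaIdeal a b c)) = (m : WithBot ℕ∞) := by
  refine le_antisymm ?_ ?_
  · refine ringKrullDim_quotient_le_of_lauricella_symbols _ fun i => ?_
    -- Only the symbols of the generators are needed, though they need not generate the
    -- characteristic ideal.
    refine le_vanishingIdeal_zeroLocus _ (Ideal.subset_span ?_)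
    exact ⟨_, Ideal.subset_span ⟨i, rfl⟩, Weyl.principalSymbol_lauricellaOp a b c i⟩
  · obtain ⟨f, hf, hsol⟩ := exists_powerSeries_solution a b c
    refine le_algebraicSetDim_of_zeroSection_subset
      (Weyl.zeroSection_subset_charVariety hf fun P hP => ?_)
    refine Weyl.powerSeriesAction_eq_zero_of_mem_span ?_ hP
    rintro _ ⟨i, rfl⟩
    exact hsol i

end

theorem mainTheorem9 (m : ℕ) (a b : ℂ) (c : Fin m → ℂ) :
    algebraicSetDim (Weyl.charVariety (lauricellaIdeal a b c)) = (m : WithBot ℕ∞) ∧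
      Weyl.IsHolonomic (lauricellaIdeal a b c) :=
  ⟨algebraicSetDim_charVariety_lauricellaIdeal a b c,
    algebraicSetDim_charVariety_lauricellaIdeal a b c⟩
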